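/- Let $T_m$ be the set of $321$-avoiding permutations in the symmetric group $\mathcal S_m$, that is, those with no decreasing subsequence of length three. For $\pi\in\mathcal S_m$ let $\mathrm{lis}(\pi)$ be the length of the longest increasing subsequence of $\pi$, and let $\mathrm{ldes}(\pi)$ be the largest $i\in\{1,\dots,m-1\}$ with $\pi_i>\pi_{i+1}$ (with $\mathrm{ldes}(\mathrm{id})=0$). Let $T^*_m$ (resp. $T^\star_m$) be the set of all $\pi\in T_m$ for which $\mathrm{ldes}(\pi)$ is even and $\mathrm{lis}(\pi)$ is odd (resp. even). Then for all $n\ge 1$, as identities of polynomials in $q$ and $t$ with integer coefficients (equivalently, for all elements $q,t$ of any commutative ring), $$\sum_{\pi\in T_n} q^{2\,\mathrm{lis}(\pi)+1}t^{2\,\mathrm{ldes}(\pi)}=\sum_{\pi\in T^*_{2n+1}}\mathrm{sign}(\pi)\,q^{\mathrm{lis}(\pi)}t^{\mathrm{ldes}(\pi)}$$ and $$\sum_{\pi\in T_n} q^{2\,\mathrm{lis}(\pi)+1}t^{2\,\mathrm{ldes}(\pi)}=\sum_{\pi\in T^*_{2n}}\mathrm{sign}(\pi)\,q^{\mathrm{lis}(\pi)}t^{\mathrm{ldes}(\pi)}+q\sum_{\pi\in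 T^\star_{2n}}\mathrm{sign}(\pi)\,q^{\mathrm{lis}(\pi)}t^{\mathrm{ldes}(\pi)}.$$ -/

import Mathlib

namespace SignBalance

/-- A permutation is 321-avoiding if it has no decreasing subsequence of length three. -/
def Avoids321 {n : ℕ} (π : Equiv.Perm (Fin n)) : Prop :=
  ¬ ∃ i j k : Fin n, i < j ∧ j < k ∧ π k < π j ∧ π j < π i

instance {n : ℕ} (π : Equiv.Perm (Fin n)) : Decidable (Avoids321 π) := by
  unfold Avoids321; infer_instance

/-- `s` is the set of positions of an increasing subsequence of `π`. -/
def IsIncreasingOn {n : ℕ} (π : Equiv.Perm (Fin n)) (s : Finset (Fin n)) : Prop :=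
  ∀ i ∈ s, ∀ j ∈ s, i < j → π i < π j

instance {n : ℕ} (π : Equiv.Perm (Fin n)) : DecidablePred (IsIncreasingOn π) := fun s => by
  unfold IsIncreasingOn; infer_instance

/-- The length of the longest increasing subsequence of `π`. -/
def lis {n : ℕ} (π : Equiv.Perm (Fin n)) : ℕ :=
  (Finset.univ.filter (IsIncreasingOn π)).sup Finset.card

/-- The descent set of `π`, with positions counted from 1: the element `i : Fin n` stands for the
position `i + 1`, and this position is a descent if the letter there exceeds the next one. -/
def descents {n : ℕ} (π : Equiv.Perm (Fin n)) : Finset ℕ :=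
  Finset.image (fun i : Fin n => (i : ℕ) + 1)
    (Finset.univ.filter fun i : Fin n => ∃ j : Fin n, (j : ℕ) = i + 1 ∧ π j < π i)

/-- The last (maximum) descent of `π`; it is `0` if there is no descent, i.e. for the identity. -/
def ldes {n : ℕ} (π : Equiv.Perm (Fin n)) : ℕ := (descents π).sup id

/-- The set of 321-avoiding permutations of length `n`. -/
def T (n : ℕ) : Finset (Equiv.Perm (Fin n)) := Finset.univ.filter Avoids321

/-- The 321-avoiding permutations with even last descent and odd longest increasing
subsequence length. -/
def TOdd (n : ℕ) : Finset (Equiv.Perm (Fin n)) :=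
  (T n).filter fun π => Even (ldes π) ∧ Odd (lis π)

/-- The 321-avoiding permutations with even last descent and even longest increasing
subsequence length. -/
def TEven (n : ℕ) : Finset (Equiv.Perm (Fin n)) :=
  (T n).filter fun π => Even (ldes π) ∧ Even (lis π)

end SignBalance

/-! The permutations in `T (m + 1)` arise from those in `T m` by inserting the largest letter at a
position `k` with `ldes π ≤ k`: the new letter can only be the first of a 321 pattern, so the
letters behind it must increase. Insertion multiplies the sign by `(-1) ^ (m - k)`, makes `k + 1`
the last descent unless the letter goes to the end, and gives `lis = max (prefixLis π k + 1) (lis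
π)`. A closed recursion therefore needs a third statistic besides `ldes` and `lis`: `prefixLis` at
the last descent.

The resulting refined counts factor, up to a power of `ε`, into two ballot numbers, one depending on
`lis` alone and one on the last descent and `prefixLis` there. A character `χ` of `ℤˣ` treats plain
counting (`ε = 1`) and signed counting (`ε = -1`) at once.

At `ε = -1` the ballot numbers either vanish or equal ordinary ones at halved arguments
(`ballot_neg_one`). Hence, for even last descent, odd values of `prefixLis` contribute nothing, and
the even ones reproduce the plain refined count for `n`: term by term for length `2 * n + 1`, and as
a sum of two adjacent `lis` values for length `2 * n`. -/

namespace SignBalance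

/-! ### Insertion of a new largest letter -/

/-- Insert the new largest letter at position `k`. -/
def insertLast {m : ℕ} (π : Equiv.Perm (Fin m)) (k : Fin (m + 1)) : Equiv.Perm (Fin (m + 1)) :=
  (Fin.cycleIcc k (Fin.last m)).symm.trans
    ((finSuccEquivLast.trans (Equiv.optionCongr π)).trans finSuccEquivLast.symm)

@[simp]
theorem insertLast_self {m : ℕ} (π : Equiv.Perm (Fin m)) (k : Fin (m + 1)) :
    insertLast π k k = Fin.last m := by
  have h : (Fin.cycleIcc k (Fin.last m)).symm k = Fin.last m := by
    rw [Equiv.symm_apply_eq, Fin.cycleIcc_of_last (Fin.le_last k)]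
  simp [insertLast, h]

@[simp]
theorem insertLast_succAbove {m : ℕ} (π : Equiv.Perm (Fin m)) (k : Fin (m + 1)) (i : Fin m) :
    insertLast π k (k.succAbove i) = (π i).castSucc := by
  have h : (Fin.cycleIcc k (Fin.last m)).symm (k.succAbove i) = i.castSucc := by
    rw [Equiv.symm_apply_eq, ← Fin.succAbove_last_apply]
    exact (congrFun (Fin.cycleIcc_comp_succAbove k _ (Fin.le_last k)) i).symm
  simp [insertLast, h]

/-- The position shift is a cycle on `m - k + 1` points, and extending `π` by a fixed point keeps
its sign. -/
theorem sign_insertLast {m : ℕ} (π : Equiv.Perm (Fin m)) (k : Fin (m + 1)) :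
    Equiv.Perm.sign (insertLast π k) = (-1) ^ (m - k : ℕ) * Equiv.Perm.sign π := by
  have h := Equiv.Perm.sign_symm_trans_trans (Equiv.optionCongr π)
    (finSuccEquivLast (n := m)).symm
  rw [Equiv.optionCongr_sign, Equiv.symm_symm] at h
  rw [insertLast, Equiv.Perm.sign_trans, Equiv.Perm.sign_symm,
    Fin.sign_cycleIcc_of_le (Fin.le_last k), h, mul_comm, Fin.val_last]

theorem insertLast_injective {m : ℕ} :
    Function.Injective fun x : Equiv.Perm (Fin m) × Fin (m + 1) => insertLast x.1 x.2 := by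
  rintro ⟨π, k⟩ ⟨σ, l⟩ h
  simp only at h
  have hk : k = l := by
    apply (insertLast π k).injective
    rw [insertLast_self, h, insertLast_self]
  subst hk
  refine Prod.ext (Equiv.ext fun i => ?_) rfl
  have := congrArg (fun e => e (k.succAbove i)) h
  simpa using this

theorem insertLast_bijective {m : ℕ} :
    Function.Bijective fun x : Equiv.Perm (Fin m) × Fin (m + 1) => insertLast x.1 x.2 := by
  rw [Fintype.bijective_iff_injective_and_card]
  refine ⟨insertLast_injective, ?_⟩
  simp [Fintype.card_perm, Nat.factorial_succ, mul_comm]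

theorem ldes_le_iff_succ {m : ℕ} (π : Equiv.Perm (Fin m)) (k : ℕ) :
    ldes π ≤ k ↔ ∀ i j : Fin m, k ≤ i → (j : ℕ) = i + 1 → π i < π j := by
  simp only [ldes, Finset.sup_le_iff, descents, Finset.mem_image, Finset.mem_filter,
    Finset.mem_univ, true_and, id_eq]
  constructor
  · intro h i j hi hj
    by_contra hlt
    have hne : π i ≠ π j := fun h => by
      have := congrArg Fin.val (π.injective h)
      omega
    have := h (i + 1) ⟨i, ⟨j, hj, lt_of_le_of_ne (not_lt.1 hlt) hne.symm⟩, rfl⟩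
    omega
  · rintro h _ ⟨i, ⟨j, hj, hlt⟩, rfl⟩
    by_contra hc
    exact absurd (h i j (by omega) hj) (not_lt.2 hlt.le)

theorem ldes_le_iff {m : ℕ} (π : Equiv.Perm (Fin m)) (k : ℕ) :
    ldes π ≤ k ↔ ∀ i j : Fin m, k ≤ i → i < j → π i < π j := by
  rw [ldes_le_iff_succ]
  constructor
  · intro h i j hi hij
    obtain ⟨c, hc⟩ : ∃ c : ℕ, (j : ℕ) = i + 1 + c :=
      ⟨j - i - 1, by have : (i : ℕ) < j := hij; omega⟩
    induction c generalizing j with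
    | zero => exact h i j hi hc
    | succ c ih =>
      let j' : Fin m := ⟨i + 1 + c, by omega⟩
      exact (ih j' (Fin.lt_def.2 (by simp [j']; omega)) rfl).trans
        (h j' j (by simp [j']; omega) (by simp [j']; omega))
  · intro h i j hi hj
    exact h i j hi (Fin.lt_def.2 (by omega))

theorem ldes_le {m : ℕ} (π : Equiv.Perm (Fin m)) : ldes π ≤ m - 1 :=
  (ldes_le_iff π _).2 fun i j hi hij => absurd (Fin.lt_def.1 hij) (by omega)

theorem succAbove_val {m : ℕ} (k : Fin (m + 1)) (i : Fin m) :
    (k.succAbove i : ℕ) = if (i : ℕ) < k then (i : ℕ) else i + 1 := by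
  split_ifs with h
  · rw [Fin.succAbove_of_castSucc_lt _ _ (by simpa [Fin.lt_def] using h)]; rfl
  · rw [Fin.succAbove_of_le_castSucc _ _ (by simpa [Fin.le_def] using h)]; rfl

theorem ldes_insertLast_last {m : ℕ} (π : Equiv.Perm (Fin m)) :
    ldes (insertLast π (Fin.last m)) = ldes π := by
  refine eq_of_forall_ge_iff fun c => ?_
  have h (i : Fin m) : insertLast π (Fin.last m) i.castSucc = (π i).castSucc := by
    rw [← Fin.succAbove_last_apply, insertLast_succAbove]
  simp [ldes_le_iff, Fin.forall_iff_succAbove (Fin.last m), h, Fin.castSucc_lt_last,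
    Fin.not_lt.2 (Fin.le_last _)]

theorem ldes_insertLast {m : ℕ} (π : Equiv.Perm (Fin m)) (k : Fin (m + 1)) (hk : (k : ℕ) < m)
    (h : ldes π ≤ k) : ldes (insertLast π k) = k + 1 := by
  rw [ldes_le_iff] at h
  refine eq_of_forall_ge_iff fun c => ?_
  rw [ldes_le_iff]
  constructor
  · intro hc
    by_contra hlt
    have := hc k (k.succAbove ⟨k, hk⟩) (by omega) (by rw [Fin.lt_def, succAbove_val]; simp)
    rw [insertLast_self] at this
    exact absurd this (not_lt.2 (Fin.le_last _))
  · intro hc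
    simp only [Fin.forall_iff_succAbove k, insertLast_self, insertLast_succAbove]
    refine ⟨⟨by simp, fun i hi => by omega⟩, fun i => ⟨fun _ _ => Fin.castSucc_lt_last _, ?_⟩⟩
    intro j hi hij
    rw [Fin.succAbove_lt_succAbove_iff] at hij
    rw [Fin.castSucc_lt_castSucc_iff]
    refine h i j ?_ hij
    rw [succAbove_val] at hi
    split_ifs at hi <;> omega

/-- A largest letter can only play the role of the 3, so it creates a 321 pattern exactly when there
is an inversion behind it. -/
theorem avoids321_insertLast {m : ℕ} (π : Equiv.Perm (Fin m)) (k : Fin (m + 1)) :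
    Avoids321 (insertLast π k) ↔ Avoids321 π ∧ ldes π ≤ k := by
  rw [ldes_le_iff]
  unfold Avoids321
  constructor
  · intro h
    refine ⟨?_, ?_⟩
    · rintro ⟨i, j, l, hij, hjl, h1, h2⟩
      exact h ⟨k.succAbove i, k.succAbove j, k.succAbove l, by simpa, by simpa, by simpa, by simpa⟩
    · intro i j hi hij
      by_contra hlt
      have hne : π i ≠ π j := fun h => hij.ne (π.injective h)
      refine h ⟨k, k.succAbove i, k.succAbove j, ?_, by simpa, ?_, ?_⟩
      · rw [Fin.lt_def, succAbove_val, if_neg (by omega)]; omega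
      · simpa using lt_of_le_of_ne (not_lt.1 hlt) hne.symm
      · simp [Fin.castSucc_lt_last]
  · rintro ⟨h, hk⟩ ⟨i, j, l, hij, hjl, h1, h2⟩
    have hj : j ≠ k := by
      rintro rfl; rw [insertLast_self] at h2; exact absurd h2 (not_lt.2 (Fin.le_last _))
    have hl : l ≠ k := by
      rintro rfl; rw [insertLast_self] at h1; exact absurd h1 (not_lt.2 (Fin.le_last _))
    obtain ⟨j, rfl⟩ := Fin.exists_succAbove_eq hj
    obtain ⟨l, rfl⟩ := Fin.exists_succAbove_eq hl
    rw [insertLast_succAbove, insertLast_succAbove, Fin.castSucc_lt_castSucc_iff] at h1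
    rw [Fin.succAbove_lt_succAbove_iff] at hjl
    by_cases hi : i = k
    · subst hi
      refine absurd (hk j l ?_ hjl) (not_lt.2 h1.le)
      rw [Fin.lt_def, succAbove_val] at hij
      split_ifs at hij <;> omega
    · obtain ⟨i, rfl⟩ := Fin.exists_succAbove_eq hi
      rw [insertLast_succAbove, insertLast_succAbove, Fin.castSucc_lt_castSucc_iff] at h2
      rw [Fin.succAbove_lt_succAbove_iff] at hij
      exact h ⟨i, j, l, hij, hjl, h1, h2⟩

/-! ### Longest increasing subsequences of prefixes -/

/-- Length of the longest increasing subsequence of the first `k` letters of `π`. -/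
def prefixLis {m : ℕ} (π : Equiv.Perm (Fin m)) (k : ℕ) : ℕ :=
  (Finset.univ.filter fun s : Finset (Fin m) => IsIncreasingOn π s ∧ ∀ i ∈ s, (i : ℕ) < k).sup
    Finset.card

theorem prefixLis_le_iff {m : ℕ} (π : Equiv.Perm (Fin m)) (k c : ℕ) :
    prefixLis π k ≤ c ↔
      ∀ s : Finset (Fin m), IsIncreasingOn π s → (∀ i ∈ s, (i : ℕ) < k) → s.card ≤ c := by
  simp [prefixLis, Finset.sup_le_iff]

theorem card_le_prefixLis {m : ℕ} {π : Equiv.Perm (Fin m)} {k : ℕ} {s : Finset (Fin m)}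
    (hs : IsIncreasingOn π s) (hk : ∀ i ∈ s, (i : ℕ) < k) : s.card ≤ prefixLis π k :=
  (prefixLis_le_iff π k _).1 le_rfl s hs hk

theorem exists_card_eq_prefixLis {m : ℕ} (π : Equiv.Perm (Fin m)) (k : ℕ) :
    ∃ s : Finset (Fin m), IsIncreasingOn π s ∧ (∀ i ∈ s, (i : ℕ) < k) ∧
      s.card = prefixLis π k := by
  obtain ⟨s, hs, h⟩ := Finset.exists_mem_eq_sup (Finset.univ.filter
    fun s : Finset (Fin m) => IsIncreasingOn π s ∧ ∀ i ∈ s, (i : ℕ) < k)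
    ⟨∅, Finset.mem_filter.2 ⟨Finset.mem_univ _, by simp [IsIncreasingOn]⟩⟩ Finset.card
  simp only [Finset.mem_filter, Finset.mem_univ, true_and] at hs
  exact ⟨s, hs.1, hs.2, h.symm⟩

theorem IsIncreasingOn.subset {m : ℕ} {π : Equiv.Perm (Fin m)} {s t : Finset (Fin m)}
    (ht : IsIncreasingOn π t) (h : s ⊆ t) : IsIncreasingOn π s :=
  fun i hi j hj => ht i (h hi) j (h hj)

theorem prefixLis_of_le {m : ℕ} (π : Equiv.Perm (Fin m)) {k : ℕ} (hk : m ≤ k) :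
    prefixLis π k = lis π := by
  unfold prefixLis lis
  congr 1
  ext s
  simp only [Finset.mem_filter, Finset.mem_univ, true_and, and_iff_left_iff_imp]
  exact fun _ i _ => i.2.trans_le hk

theorem prefixLis_le {m : ℕ} (π : Equiv.Perm (Fin m)) (k : ℕ) : prefixLis π k ≤ k := by
  rw [prefixLis_le_iff]
  intro s _ hk
  calc s.card = (s.map Fin.valEmbedding).card := (Finset.card_map _).symm
    _ ≤ (Finset.range k).card := Finset.card_le_card fun i hi => by
        obtain ⟨j, hj, rfl⟩ := Finset.mem_map.1 hi
        exact Finset.mem_range.2 (hk j hj)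
    _ = k := Finset.card_range k

theorem prefixLis_pos {m : ℕ} (π : Equiv.Perm (Fin m)) (hm : 0 < m) {k : ℕ} (hk : 0 < k) :
    0 < prefixLis π k := by
  have := card_le_prefixLis (π := π) (k := k) (s := {⟨0, hm⟩}) (by simp [IsIncreasingOn])
    (by simpa using hk)
  rwa [Finset.card_singleton] at this

theorem prefixLis_zero {m : ℕ} (π : Equiv.Perm (Fin m)) : prefixLis π 0 = 0 :=
  Nat.le_zero.1 (prefixLis_le π 0)

theorem prefixLis_mono {m : ℕ} (π : Equiv.Perm (Fin m)) : Monotone (prefixLis π) := by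
  intro k l hkl
  rw [prefixLis_le_iff]
  exact fun s hs hk => card_le_prefixLis hs fun i hi => (hk i hi).trans_le hkl

theorem prefixLis_succ_le {m : ℕ} (π : Equiv.Perm (Fin m)) (k : ℕ) :
    prefixLis π (k + 1) ≤ prefixLis π k + 1 := by
  rw [prefixLis_le_iff]
  intro s hs hk
  by_cases h : ∃ i ∈ s, (i : ℕ) = k
  · obtain ⟨i, hi, hik⟩ := h
    have := card_le_prefixLis (k := k) (hs.subset (Finset.erase_subset i s)) (fun j hj => by
      have h1 := hk j (Finset.mem_of_mem_erase hj)
      have h2 := Finset.ne_of_mem_erase hj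
      rw [Ne, Fin.ext_iff] at h2
      omega)
    rw [Finset.card_erase_of_mem hi] at this
    omega
  · push Not at h
    exact (card_le_prefixLis hs fun j hj => by
      have := hk j hj; have := h j hj; omega).trans (Nat.le_succ _)

/-- If the statistic grows when position `k` is admitted, every optimal subsequence ends at `k`; the
ascent then lets `k + 1` be appended. -/
theorem prefixLis_succ_succ {m : ℕ} (π : Equiv.Perm (Fin m)) {k : ℕ} (hk : k + 1 < m)
    (hπ : π ⟨k, by omega⟩ < π ⟨k + 1, hk⟩) (h : prefixLis π (k + 1) = prefixLis π k + 1) :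
    prefixLis π (k + 2) = prefixLis π (k + 1) + 1 := by
  refine le_antisymm (prefixLis_succ_le π _) ?_
  obtain ⟨s, hs, hsk, hc⟩ := exists_card_eq_prefixLis π (k + 1)
  have hmem : (⟨k, by omega⟩ : Fin m) ∈ s := by
    by_contra hn
    have := card_le_prefixLis (k := k) hs fun j hj => by
      have h1 := hsk j hj
      have h2 : j ≠ ⟨k, by omega⟩ := fun h => hn (h ▸ hj)
      rw [Ne, Fin.ext_iff] at h2
      simp only at h2
      omega
    omega
  have hnot : (⟨k + 1, hk⟩ : Fin m) ∉ s := fun h => by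
    have := hsk _ h
    simp at this
  rw [← hc, ← Finset.card_insert_of_notMem hnot]
  refine card_le_prefixLis ?_ ?_
  · intro i hi j hj hij
    rw [Finset.mem_insert] at hi hj
    rcases hi with rfl | hi <;> rcases hj with rfl | hj
    · exact absurd hij (lt_irrefl _)
    · have := hsk j hj
      rw [Fin.lt_def] at hij
      simp only at hij
      omega
    · rcases eq_or_ne i ⟨k, by omega⟩ with hik | hne
      · exact hik ▸ hπ
      · refine (hs i hi _ hmem ?_).trans hπ
        have := hsk i hi
        rw [Ne, Fin.ext_iff] at hne
        rw [Fin.lt_def]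
        simp only at hne ⊢
        omega
    · exact hs i hi j hj hij
  · intro i hi
    rw [Finset.mem_insert] at hi
    rcases hi with rfl | hi
    · simp
    · have := hsk i hi; omega

/-- Behind the last descent, the prefix statistic first stays constant and then grows by one
at each step. -/
theorem prefixLis_succ_eq_or {m : ℕ} (π : Equiv.Perm (Fin m)) {k : ℕ} (hd : ldes π ≤ k)
    (hk : k < m) :
    prefixLis π (k + 1) = prefixLis π k ∧ lis π + (k + 1) ≤ m + prefixLis π (k + 1) ∨
      prefixLis π (k + 1) = prefixLis π k + 1 ∧ lis π + (k + 1) = m + prefixLis π (k + 1) := by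
  have hstep : ∀ c, prefixLis π (k + 1 + c) ≤ prefixLis π (k + 1) + c := by
    intro c
    induction c with
    | zero => rfl
    | succ c ih =>
      have := prefixLis_succ_le π (k + 1 + c)
      rw [← add_assoc]
      omega
  have hm : k + 1 + (m - (k + 1)) = m := by omega
  have h0 := hstep (m - (k + 1))
  rw [hm, prefixLis_of_le π le_rfl] at h0
  have h1 : prefixLis π k ≤ prefixLis π (k + 1) := prefixLis_mono π (Nat.le_succ k)
  have h2 := prefixLis_succ_le π k
  rcases (show prefixLis π (k + 1) = prefixLis π k ∨ prefixLis π (k + 1) = prefixLis π k + 1 by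
    omega) with h | h
  · exact Or.inl ⟨h, by omega⟩
  · refine Or.inr ⟨h, ?_⟩
    -- Only ascents remain from `k` on, so growth once begun persists up to `m`; this pins down `lis
    -- π`.
    have hrise : ∀ c, k + c < m → prefixLis π (k + c + 1) = prefixLis π (k + c) + 1 := by
      intro c
      induction c with
      | zero => exact fun _ => h
      | succ c ih =>
        intro hc
        exact prefixLis_succ_succ π (by omega)
          ((ldes_le_iff_succ π k).1 hd _ _ (by simp) (by simp)) (ih (by omega))
    have hall : ∀ c, k + c < m → prefixLis π (k + c + 1) = prefixLis π (k + 1) + c := by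
      intro c
      induction c with
      | zero => exact fun _ => rfl
      | succ c ih =>
        intro hc
        rw [hrise _ hc, ← add_assoc, ih (by omega), add_assoc]
    have := hall (m - (k + 1)) (by omega)
    rw [show k + (m - (k + 1)) + 1 = m by omega, prefixLis_of_le π le_rfl] at this
    omega

/-! ### Prefix statistics under insertion -/

theorem isIncreasingOn_map_succAbove {m : ℕ} (π : Equiv.Perm (Fin m)) (k : Fin (m + 1))
    (s : Finset (Fin m)) :
    IsIncreasingOn (insertLast π k) (s.map k.succAboveEmb) ↔ IsIncreasingOn π s := by
  simp [IsIncreasingOn]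

theorem exists_eq_map_succAbove {m : ℕ} {k : Fin (m + 1)} {s : Finset (Fin (m + 1))}
    (hk : k ∉ s) : ∃ t : Finset (Fin m), s = t.map k.succAboveEmb := by
  refine ⟨Finset.univ.filter fun i => k.succAbove i ∈ s, ?_⟩
  ext j
  simp only [Finset.mem_map, Finset.mem_filter, Finset.mem_univ, true_and]
  constructor
  · intro hj
    obtain ⟨i, rfl⟩ := Fin.exists_succAbove_eq (fun h : j = k => hk (h ▸ hj))
    exact ⟨i, hj, rfl⟩
  · rintro ⟨i, hi, rfl⟩
    exact hi

theorem prefixLis_insertLast_of_le {m : ℕ} (π : Equiv.Perm (Fin m)) (k : Fin (m + 1)) {j : ℕ}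
    (hj : j ≤ k) : prefixLis (insertLast π k) j = prefixLis π j := by
  refine eq_of_forall_ge_iff fun c => ?_
  simp only [prefixLis_le_iff]
  constructor
  · intro h s hs hsj
    rw [← Finset.card_map k.succAboveEmb]
    refine h _ ((isIncreasingOn_map_succAbove π k s).2 hs) ?_
    intro i hi
    obtain ⟨i, his, rfl⟩ := Finset.mem_map.1 hi
    have := hsj i his
    change (k.succAbove i : ℕ) < j
    rw [succAbove_val, if_pos (by omega)]
    exact this
  · intro h s hs hsj
    have hk : k ∉ s := fun hk => by have := hsj k hk; omega
    obtain ⟨t, rfl⟩ := exists_eq_map_succAbove hk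
    rw [Finset.card_map]
    refine h t ((isIncreasingOn_map_succAbove π k t).1 hs) fun i hi => ?_
    have : (k.succAbove i : ℕ) < j := hsj _ (Finset.mem_map_of_mem _ hi)
    rw [succAbove_val] at this
    split_ifs at this <;> omega

/-- An increasing subsequence using the largest letter must end there, so its other positions lie
before `k`; one not using it already lives in `π`. -/
theorem prefixLis_insertLast_succ {m : ℕ} (π : Equiv.Perm (Fin m)) (k : Fin (m + 1)) {j : ℕ}
    (hj : k ≤ j) :
    prefixLis (insertLast π k) (j + 1) = max (prefixLis π k + 1) (prefixLis π j) := by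
  refine le_antisymm ?_ (max_le ?_ ?_)
  · rw [prefixLis_le_iff]
    intro s hs hsj
    by_cases hk : k ∈ s
    · refine le_max_of_le_left ?_
      have hlt : ∀ i ∈ s.erase k, (i : ℕ) < k := by
        intro i hi
        have hne := Finset.ne_of_mem_erase hi
        by_contra hc
        have hki : k < i := lt_of_le_of_ne (not_lt.1 fun h => hc h) hne.symm
        have := hs k hk i (Finset.mem_of_mem_erase hi) hki
        rw [insertLast_self] at this
        exact absurd this (not_lt.2 (Fin.le_last _))
      have := card_le_prefixLis (hs.subset (Finset.erase_subset k s)) hlt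
      rw [Finset.card_erase_of_mem hk, prefixLis_insertLast_of_le π k le_rfl] at this
      omega
    · refine le_max_of_le_right ?_
      obtain ⟨t, rfl⟩ := exists_eq_map_succAbove hk
      rw [Finset.card_map]
      refine card_le_prefixLis ((isIncreasingOn_map_succAbove π k t).1 hs) fun i hi => ?_
      have : (k.succAbove i : ℕ) < j + 1 := hsj _ (Finset.mem_map_of_mem _ hi)
      rw [succAbove_val] at this
      split_ifs at this <;> omega
  · obtain ⟨s, hs, hsk, hc⟩ := exists_card_eq_prefixLis (insertLast π k) k
    rw [prefixLis_insertLast_of_le π k le_rfl] at hc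
    have hn : k ∉ s := fun h => lt_irrefl _ (hsk k h)
    rw [← hc, ← Finset.card_insert_of_notMem hn]
    refine card_le_prefixLis ?_ ?_
    · intro a ha b hb hab
      rw [Finset.mem_insert] at ha hb
      rcases ha with rfl | ha <;> rcases hb with rfl | hb
      · exact absurd hab (lt_irrefl _)
      · exact absurd hab (not_lt.2 (Fin.le_def.2 (hsk b hb).le))
      · rw [insertLast_self]
        refine lt_of_le_of_ne (Fin.le_last _) fun h => hn ?_
        rw [← insertLast_self π b] at h
        exact (insertLast π b).injective h ▸ ha
      · exact hs a ha b hb hab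
    · intro i hi
      rw [Finset.mem_insert] at hi
      rcases hi with rfl | hi
      · omega
      · have := hsk i hi; omega
  · obtain ⟨s, hs, hsk, hc⟩ := exists_card_eq_prefixLis π j
    rw [← hc, ← Finset.card_map k.succAboveEmb]
    refine card_le_prefixLis ((isIncreasingOn_map_succAbove π k s).2 hs) ?_
    intro i hi
    obtain ⟨i, his, rfl⟩ := Finset.mem_map.1 hi
    have := hsk i his
    change (k.succAbove i : ℕ) < j + 1
    rw [succAbove_val]
    split_ifs <;> omega

theorem lis_insertLast {m : ℕ} (π : Equiv.Perm (Fin m)) (k : Fin (m + 1)) :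
    lis (insertLast π k) = max (prefixLis π k + 1) (lis π) := by
  rw [← prefixLis_of_le _ le_rfl, prefixLis_insertLast_succ _ _ (Nat.lt_succ_iff.1 k.2),
    prefixLis_of_le π le_rfl]

theorem lis_insertLast_last {m : ℕ} (π : Equiv.Perm (Fin m)) :
    lis (insertLast π (Fin.last m)) = lis π + 1 := by
  rw [lis_insertLast, Fin.val_last, prefixLis_of_le π le_rfl]
  simp

theorem prefixLis_le_lis {m : ℕ} (π : Equiv.Perm (Fin m)) (k : ℕ) : prefixLis π k ≤ lis π := by
  rw [← prefixLis_of_le π (le_max_right k m)]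
  exact prefixLis_mono π (le_max_left k m)

theorem lis_le {m : ℕ} (π : Equiv.Perm (Fin m)) : lis π ≤ m := by
  rw [← prefixLis_of_le π le_rfl]
  exact prefixLis_le π m

/-! ### Refined weighted counts and their recursions -/

/-- The weight of a permutation: its sign or `1`, depending on the character `χ` of `ℤˣ`. -/
def weight (χ : ℤˣ →* ℤˣ) {m : ℕ} (π : Equiv.Perm (Fin m)) : ℤ := (χ (Equiv.Perm.sign π) : ℤˣ)

theorem weight_insertLast (χ : ℤˣ →* ℤˣ) {m : ℕ} (π : Equiv.Perm (Fin m)) (k : Fin (m + 1)) :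
    weight χ (insertLast π k) = ((χ (-1) : ℤˣ) : ℤ) ^ (m - k : ℕ) * weight χ π := by
  simp [weight, sign_insertLast]

theorem sum_T_succ {M : Type*} [AddCommMonoid M] {m : ℕ} (F : Equiv.Perm (Fin (m + 1)) → M) :
    ∑ π ∈ T (m + 1), F π = ∑ π ∈ T m,
      ((∑ k : Fin m, if ldes π ≤ k then F (insertLast π k.castSucc) else 0) +
        F (insertLast π (Fin.last m))) := by
  have h1 : ∑ π ∈ T (m + 1), F π = ∑ x : Equiv.Perm (Fin m) × Fin (m + 1),
      if Avoids321 (insertLast x.1 x.2) then F (insertLast x.1 x.2) else 0 := by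
    rw [insertLast_bijective.sum_comp (fun π => if Avoids321 π then F π else 0), T,
      Finset.sum_filter]
  rw [h1, Fintype.sum_prod_type, T, Finset.sum_filter]
  refine Finset.sum_congr rfl fun π _ => ?_
  by_cases hπ : Avoids321 π
  · have := ldes_le π
    rw [if_pos hπ, Fin.sum_univ_castSucc]
    simp only [avoids321_insertLast, hπ, true_and, Fin.val_castSucc, Fin.val_last]
    rw [if_pos (by omega)]
  · rw [if_neg hπ]
    exact Finset.sum_eq_zero fun k _ => if_neg fun h => hπ ((avoids321_insertLast π k).1 h).1

/-- Weighted number of the 321-avoiding permutations with last descent `d`, with `prefixLis` equal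
to `a` there, and with longest increasing subsequences of length `l`. -/
def exactCount (χ : ℤˣ →* ℤˣ) (m d a l : ℕ) : ℤ :=
  ∑ π ∈ T m, if ldes π = d ∧ prefixLis π d = a ∧ lis π = l then weight χ π else 0

/-- Weighted number of the 321-avoiding permutations without descents behind position `k`, with
`prefixLis` equal to `a` there, and with longest increasing subsequences of length `l`. -/
def boundedCount (χ : ℤˣ →* ℤˣ) (m k a l : ℕ) : ℤ :=
  ∑ π ∈ T m, if ldes π ≤ k ∧ prefixLis π k = a ∧ lis π = l then weight χ π else 0

theorem exactCount_eq_zero (χ : ℤˣ →* ℤˣ) {m d a l : ℕ}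
    (h : m - 1 < d ∨ 0 < d ∧ a = 0 ∨ l < a) : exactCount χ m d a l = 0 := by
  refine Finset.sum_eq_zero fun π _ => if_neg ?_
  rintro ⟨h1, h2, h3⟩
  have h4 := ldes_le π
  rcases h with h | h | h
  · omega
  · have := prefixLis_pos π (by omega) h.1
    omega
  · have := prefixLis_le_lis π d
    omega

/-- The first term comes from appending at the end, the rest from insertion at `k`. There `max (c +
1) (lis π) = l + 1` means either `lis π = l + 1` with `c ≤ l`, or `lis π = c = l`. -/
theorem exactCount_succ_succ (χ : ℤˣ →* ℤˣ) {m k : ℕ} (hk : k < m) (c l : ℕ) :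
    exactCount χ (m + 1) (k + 1) (c + 1) (l + 1) = exactCount χ m (k + 1) (c + 1) l +
      ((χ (-1) : ℤˣ) : ℤ) ^ (m - k) * ((if c ≤ l then boundedCount χ m k c (l + 1) else 0) +
        if l = c then boundedCount χ m k c c else 0) := by
  have h1 : ∀ P : Prop, [Decidable P] → ∀ F : Equiv.Perm (Fin m) → ℤ,
      (if P then ∑ π ∈ T m, F π else 0) = ∑ π ∈ T m, if P then F π else 0 := by
    intro P _ F
    split_ifs <;> simp
  simp only [exactCount, boundedCount]
  rw [sum_T_succ, h1, h1, ← Finset.sum_add_distrib, Finset.mul_sum, ← Finset.sum_add_distrib]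
  refine Finset.sum_congr rfl fun π _ => ?_
  rw [add_comm]
  congr 1
  · rw [ldes_insertLast_last, prefixLis_insertLast_of_le _ _ (by simpa using hk),
      lis_insertLast_last, weight_insertLast]
    simp
  · rw [Finset.sum_eq_single ⟨k, hk⟩]
    · by_cases hd : ldes π ≤ k
      · have h2 : prefixLis (insertLast π (⟨k, hk⟩ : Fin m).castSucc) (k + 1)
            = prefixLis π k + 1 := by
          have := prefixLis_insertLast_succ π (⟨k, hk⟩ : Fin m).castSucc (j := k) le_rfl
          simpa using this
        rw [if_pos hd, ldes_insertLast _ _ hk hd, h2, lis_insertLast, weight_insertLast]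
        simp only [Fin.val_castSucc, true_and, hd]
        have h3 := prefixLis_le_lis π k
        by_cases hc : prefixLis π k = c
        · simp only [hc, true_and]
          rw [hc] at h3
          rcases lt_trichotomy l c with h | h | h
          · rw [if_neg (by omega), if_neg (by omega), if_neg (by omega)]; simp
          · subst h
            rw [if_pos le_rfl, if_pos rfl]
            rcases (show lis π = l ∨ lis π = l + 1 ∨ l + 1 < lis π by omega) with h | h | h
            · simp [h]
            · simp [h]
            · rw [if_neg (by omega), if_neg (by omega), if_neg (by omega)]; simp
          · rw [if_pos h.le, if_neg h.ne', add_zero]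
            by_cases h5 : lis π = l + 1
            · rw [if_pos (by omega), if_pos h5]
            · rw [if_neg (by omega), if_neg h5, mul_zero]
        · simp [hc]
      · simp [hd]
    · intro j _ hj
      split_ifs with h2 h3
      · have h4 := ldes_insertLast π j.castSucc (by simp) h2
        rw [Fin.val_castSucc] at h4
        exact absurd (Fin.ext (by simp only; omega)) hj
      · rfl
      · rfl
    · simp

theorem exactCount_zero_left (χ : ℤˣ →* ℤˣ) (m a l : ℕ) :
    exactCount χ m 0 a l = if a = 0 ∧ l = m then 1 else 0 := by
  induction m generalizing l with
  | zero =>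
    have hT : T 0 = {1} := by decide
    have h1 : ldes (1 : Equiv.Perm (Fin 0)) = 0 := by decide
    have h2 : lis (1 : Equiv.Perm (Fin 0)) = 0 := by decide
    rw [exactCount, hT, Finset.sum_singleton, h1, h2, prefixLis_zero]
    simp [weight, eq_comm]
  | succ m ih =>
    rw [exactCount, sum_T_succ]
    have h (π : Equiv.Perm (Fin m)) (k : Fin m) (h : ldes π ≤ k) :
        ldes (insertLast π k.castSucc) ≠ 0 := by
      rw [ldes_insertLast π k.castSucc (by simp) h]; simp
    rcases l with _ | l
    · rw [if_neg (by omega)]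
      refine Finset.sum_eq_zero fun π _ => ?_
      rw [lis_insertLast_last, Finset.sum_eq_zero]
      · simp
      · intro k _
        split_ifs with h1 h2
        · exact absurd h2.1 (h π k h1)
        · rfl
        · rfl
    · simp only [add_left_inj]
      rw [← ih l, exactCount]
      refine Finset.sum_congr rfl fun π _ => ?_
      rw [Finset.sum_eq_zero, ldes_insertLast_last, lis_insertLast_last, weight_insertLast,
        prefixLis_zero, prefixLis_zero]
      · simp
      · intro k _
        split_ifs with h1 h2
        · exact absurd h2.1 (h π k h1)
        · rfl
        · rfl

theorem boundedCount_zero_left (χ : ℤˣ →* ℤˣ) (m a l : ℕ) :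
    boundedCount χ m 0 a l = if a = 0 ∧ l = m then 1 else 0 := by
  rw [← exactCount_zero_left χ, exactCount, boundedCount]
  simp only [Nat.le_zero]

theorem boundedCount_succ_zero (χ : ℤˣ →* ℤˣ) {m : ℕ} (hm : 0 < m) (k l : ℕ) :
    boundedCount χ m (k + 1) 0 l = 0 := by
  refine Finset.sum_eq_zero fun π _ => if_neg ?_
  exact fun h => (prefixLis_pos π hm k.succ_pos).ne' h.2.1

/-- Either the last descent is `k + 1`, or it is at most `k` and `prefixLis_succ_eq_or` applies: the
two conditions on `l + k` are its flat and its growing alternative. -/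
theorem boundedCount_succ_succ (χ : ℤˣ →* ℤˣ) {m k : ℕ} (hk : k < m) (c l : ℕ) :
    boundedCount χ m (k + 1) (c + 1) l = exactCount χ m (k + 1) (c + 1) l +
      ((if l + k ≤ m + c then boundedCount χ m k (c + 1) l else 0) +
        if l + k = m + c then boundedCount χ m k c l else 0) := by
  have h1 : ∀ P : Prop, [Decidable P] → ∀ F : Equiv.Perm (Fin m) → ℤ,
      (if P then ∑ π ∈ T m, F π else 0) = ∑ π ∈ T m, if P then F π else 0 := by
    intro P _ F
    split_ifs <;> simp
  simp only [exactCount, boundedCount]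
  rw [h1, h1, ← Finset.sum_add_distrib, ← Finset.sum_add_distrib]
  refine Finset.sum_congr rfl fun π _ => ?_
  rcases lt_trichotomy (ldes π) (k + 1) with h | h | h
  · have h2 := prefixLis_succ_eq_or π (Nat.lt_succ_iff.1 h) hk
    simp only [h.le, h.ne, Nat.lt_succ_iff.1 h, true_and, false_and, if_false, zero_add]
    by_cases hl : lis π = l
    · simp only [hl, and_true] at h2 ⊢
      split_ifs <;> omega
    · simp [hl]
  · simp [h]
  · rw [if_neg (by omega), if_neg (by omega), if_neg (show ¬(ldes π ≤ k ∧ _) by omega),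
      if_neg (show ¬(ldes π ≤ k ∧ _) by omega)]
    simp

/-! ### Signed ballot numbers and closed formulas -/

/-- Signed ballot numbers: for `ε = 1` the number of standard Young tableaux with rows of lengths
`a` and `b`, for `ε = -1` their sign imbalance. -/
def ballot (ε : ℤ) : ℕ → ℕ → ℤ
  | _, 0 => 1
  | 0, _ + 1 => 0
  | a + 1, b + 1 =>
    if b ≤ a then ε ^ (b + 1) * ballot ε a (b + 1) + ballot ε (a + 1) b else 0
termination_by a b => a + b

theorem ballot_zero_right (ε : ℤ) (a : ℕ) : ballot ε a 0 = 1 := by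
  cases a <;> rw [ballot]

theorem ballot_zero_left (ε : ℤ) (b : ℕ) : ballot ε 0 (b + 1) = 0 := by
  rw [ballot]

theorem ballot_succ_succ (ε : ℤ) {a b : ℕ} (h : b ≤ a) :
    ballot ε (a + 1) (b + 1) = ε ^ (b + 1) * ballot ε a (b + 1) + ballot ε (a + 1) b := by
  rw [ballot, if_pos h]

theorem ballot_eq_zero (ε : ℤ) {a b : ℕ} (h : a < b) : ballot ε a b = 0 := by
  rcases b with _ | b
  · omega
  · rcases a with _ | a
    · exact ballot_zero_left ε b
    · rw [ballot, if_neg (by omega)]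

theorem pow_eq_pow_of_even_iff {ε : ℤ} (hε : ε = 1 ∨ ε = -1) {x y : ℕ} (h : Even x ↔ Even y) :
    ε ^ x = ε ^ y := by
  rcases hε with rfl | rfl
  · simp
  · by_cases hx : Even x
    · rw [hx.neg_one_pow, (h.1 hx).neg_one_pow]
    · rw [(Nat.not_even_iff_odd.1 hx).neg_one_pow,
        (Nat.not_even_iff_odd.1 fun hy => hx (h.2 hy)).neg_one_pow]

/-- The value of `exactCount` for a positive last descent. -/
def exactFormula (ε : ℤ) (m d a l : ℕ) : ℤ :=
  if 1 ≤ a ∧ a ≤ d ∧ d + l < m + a ∧ m ≤ a + l ∧ a ≤ l ∧ l ≤ m then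
    ε ^ ((m - l) + (d - a) + (l - a) * (m - l)) * ballot ε l (m - l) * ballot ε (a - 1) (d - a)
  else 0

/-- The value of `boundedCount`. -/
def boundedFormula (ε : ℤ) (m k c l : ℕ) : ℤ :=
  if c ≤ k ∧ k + l ≤ m + c ∧ m ≤ c + l ∧ c ≤ l ∧ l ≤ m then
    ε ^ ((m - l) + (l - c) * (m - l)) * ballot ε l (m - l) * ballot ε c (k - c)
  else 0

/-- The parameters `v = k - c`, `s = l - c`, `u = m - l` remove truncated subtraction. -/
theorem boundedFormula_add (ε : ℤ) (c v s u : ℕ) (hv : v ≤ u) (hu : u ≤ c) :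
    boundedFormula ε (c + s + u) (c + v) c (c + s) =
      ε ^ (u + s * u) * ballot ε (c + s) u * ballot ε c v := by
  rw [boundedFormula, if_pos (by omega), show c + s + u - (c + s) = u by omega,
    show c + s - c = s by omega, show c + v - c = v by omega]

theorem exactFormula_add (ε : ℤ) (c v s u : ℕ) (hv : v < u) (hu : u ≤ c + 1) :
    exactFormula ε (c + s + u + 1) (c + v + 1) (c + 1) (c + s + 1) =
      ε ^ (u + v + s * u) * ballot ε (c + s + 1) u * ballot ε c v := by
  rw [exactFormula, if_pos (by omega), show c + s + u + 1 - (c + s + 1) = u by omega,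
    show c + s + 1 - (c + 1) = s by omega, show c + v + 1 - (c + 1) = v by omega,
    show c + 1 - 1 = c by omega]

/-- This is the ballot recursion in the first factor; the second factor `ballot ε c v` is common to
all terms. -/
theorem exactFormula_succ {ε : ℤ} (hε : ε = 1 ∨ ε = -1) {m k : ℕ} (hk : k < m) (c l : ℕ) :
    exactFormula ε (m + 1) (k + 1) (c + 1) (l + 1) = exactFormula ε m (k + 1) (c + 1) l +
      ε ^ (m - k) * ((if c ≤ l then boundedFormula ε m k c (l + 1) else 0) +
        if l = c then boundedFormula ε m k c c else 0) := by
  by_cases h : c ≤ k ∧ k + l < m + c ∧ m ≤ c + l + 1 ∧ c ≤ l ∧ l ≤ m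
  · obtain ⟨v, rfl⟩ := Nat.exists_eq_add_of_le h.1
    obtain ⟨s, rfl⟩ := Nat.exists_eq_add_of_le h.2.2.2.1
    obtain ⟨u, rfl⟩ : ∃ u, m = c + s + u + 1 := ⟨m - 1 - (c + s), by omega⟩
    rw [if_pos (by omega), show c + s + u + 1 + 1 = c + s + (u + 1) + 1 by ring,
      exactFormula_add _ _ _ _ _ (by omega) (by omega), ballot_succ_succ _ (by omega)]
    have hb := boundedFormula_add ε c v (s + 1) u (by omega) (by omega)
    rw [show c + (s + 1) + u = c + s + u + 1 by ring, ← add_assoc c s 1] at hb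
    rw [hb, show c + s + u + 1 - (c + v) = s + u + 1 - v by omega]
    obtain ⟨w, rfl⟩ := Nat.exists_eq_add_of_le (show v ≤ u by omega)
    rw [show s + (v + w) + 1 - v = s + w + 1 by omega]
    -- For `s = 0`, that is `l = c`, the `exactFormula` term on the right vanishes and the diagonal
    -- term `l = c` replaces it.
    rcases s with _ | s
    · have h1 : exactFormula ε (c + 0 + (v + w) + 1) (c + v + 1) (c + 1) (c + 0) = 0 := by
        rw [exactFormula, if_neg (by omega)]
      have h2 : boundedFormula ε (c + 0 + (v + w) + 1) (c + v) c c =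
          ε ^ (v + w + 1) * ballot ε c (v + w + 1) * ballot ε c v := by
        by_cases hc : v + w + 1 ≤ c
        · have := boundedFormula_add ε c v 0 (v + w + 1) (by omega) hc
          simpa [add_assoc] using this
        · rw [boundedFormula, if_neg (by omega), ballot_eq_zero ε (a := c) (by omega)]
          ring
      rw [h1, if_pos (by omega), h2, add_zero]
      have e1 : ε ^ (v + w + 1 + v + 0 * (v + w + 1)) = ε ^ (0 + w + 1) :=
        pow_eq_pow_of_even_iff hε (by
          by_cases h1 : Even v <;> by_cases h2 : Even w <;> simp [h1, h2, Nat.even_add])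
      have e2 : ε ^ (v + w + (0 + 1) * (v + w)) = 1 := by
        rw [← pow_zero ε]
        exact pow_eq_pow_of_even_iff hε (by simp [← two_mul])
      rw [e1, e2]
      ring
    · have hx := exactFormula_add ε c v s (v + w + 1) (by omega) (by omega)
      rw [show c + s + (v + w + 1) + 1 = c + (s + 1) + (v + w) + 1 by ring] at hx
      rw [← add_assoc c s 1] at hx ⊢
      rw [hx, if_neg (by omega)]
      have e1 : ε ^ (v + w + 1 + v + (s + 1) * (v + w + 1)) * ε ^ (v + w + 1) =
          ε ^ (v + w + 1 + v + s * (v + w + 1)) := by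
        rw [← pow_add]
        exact pow_eq_pow_of_even_iff hε (by
          by_cases h1 : Even s <;> by_cases h2 : Even v <;> by_cases h3 : Even w <;>
            simp [h1, h2, h3, Nat.even_add, Nat.even_mul])
      have e2 : ε ^ (s + 1 + w + 1) * ε ^ (v + w + (s + 1 + 1) * (v + w)) =
          ε ^ (v + w + 1 + v + (s + 1) * (v + w + 1)) := by
        rw [← pow_add]
        exact pow_eq_pow_of_even_iff hε (by
          by_cases h1 : Even s <;> by_cases h2 : Even v <;> by_cases h3 : Even w <;>
            simp [h1, h2, h3, Nat.even_add, Nat.even_mul])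
      linear_combination
        (ballot ε (c + s + 1) (v + w + 1) * ballot ε c v) * e1 -
          (ballot ε (c + s + 1 + 1) (v + w) * ballot ε c v) * e2
  · rw [exactFormula, if_neg (by omega), exactFormula, if_neg (by omega)]
    have h1 : (if c ≤ l then boundedFormula ε m k c (l + 1) else 0) = 0 := by
      split_ifs
      · rw [boundedFormula, if_neg (by omega)]
      · rfl
    have h2 : (if l = c then boundedFormula ε m k c c else 0) = 0 := by
      split_ifs
      · rw [boundedFormula, if_neg (by omega)]
      · rfl
    rw [h1, h2]
    ring

/-- This is the ballot recursion in the second factor. The summand with `ballot ε c v` comes from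
`exactFormula` if `v < u`, and from the growing term on the boundary `v = u`. -/
theorem boundedFormula_succ (ε : ℤ) {m k : ℕ} (hk : k < m) (c l : ℕ) :
    boundedFormula ε m (k + 1) (c + 1) l = exactFormula ε m (k + 1) (c + 1) l +
      ((if l + k ≤ m + c then boundedFormula ε m k (c + 1) l else 0) +
        if l + k = m + c then boundedFormula ε m k c l else 0) := by
  by_cases h : c ≤ k ∧ k + l ≤ m + c ∧ m ≤ c + 1 + l ∧ c + 1 ≤ l ∧ l ≤ m
  · obtain ⟨v, rfl⟩ := Nat.exists_eq_add_of_le h.1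
    obtain ⟨s, rfl⟩ := Nat.exists_eq_add_of_le h.2.2.2.1
    obtain ⟨u, rfl⟩ := Nat.exists_eq_add_of_le h.2.2.2.2
    have hb := boundedFormula_add ε (c + 1) v s u (by omega) (by omega)
    rw [show c + 1 + v = c + v + 1 by ring] at hb
    rw [hb, if_pos (by omega)]
    rcases (show v < u ∨ v = u by omega) with hu | rfl
    · have hx := exactFormula_add ε c v s u hu (by omega)
      rw [show c + s + u + 1 = c + 1 + s + u by ring, show c + s + 1 = c + 1 + s by ring] at hx
      rw [hx, if_neg (by omega), add_zero]
      rcases v with _ | v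
      · rw [boundedFormula, if_neg (by omega)]
        simp [ballot_zero_right]
      · have hb' := boundedFormula_add ε (c + 1) v s u (by omega) (by omega)
        rw [show c + 1 + v = c + (v + 1) by ring] at hb'
        rw [hb', ballot_succ_succ ε (by omega)]
        ring
    · rw [exactFormula, if_neg (by omega), if_pos (by omega)]
      have hy : boundedFormula ε (c + 1 + s + v) (c + v) c (c + 1 + s) =
          ε ^ (v + (s + 1) * v) * ballot ε (c + 1 + s) v * ballot ε c v := by
        by_cases hv : v ≤ c
        · have := boundedFormula_add ε c v (s + 1) v le_rfl hv
          rwa [show c + (s + 1) = c + 1 + s by ring] at this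
        · rw [boundedFormula, if_neg (by omega), ballot_eq_zero ε (a := c) (by omega)]
          ring
      rw [hy]
      rcases v with _ | v
      · rw [boundedFormula, if_neg (by omega)]
        simp [ballot_zero_right]
      · have hb' := boundedFormula_add ε (c + 1) v s (v + 1) (by omega) (by omega)
        rw [show c + 1 + v = c + (v + 1) by ring] at hb'
        rw [hb', ballot_succ_succ ε (by omega)]
        ring
  · rw [boundedFormula, if_neg (by omega), exactFormula, if_neg (by omega)]
    have h1 : (if l + k ≤ m + c then boundedFormula ε m k (c + 1) l else 0) = 0 := by
      split_ifs
      · rw [boundedFormula, if_neg (by omega)]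
      · rfl
    have h2 : (if l + k = m + c then boundedFormula ε m k c l else 0) = 0 := by
      split_ifs
      · by_cases hc : c = l
        · rw [boundedFormula, if_neg (by omega)]
        · rw [boundedFormula, if_neg (by omega)]
      · rfl
    rw [h1, h2]
    ring

theorem boundedCount_eq_of_exactCount (χ : ℤˣ →* ℤˣ) {ε : ℤ} {m : ℕ}
    (h : ∀ d a l, exactCount χ m (d + 1) a l = exactFormula ε m (d + 1) a l) (k : ℕ) (hk : k ≤ m)
    (c l : ℕ) : boundedCount χ m k c l = boundedFormula ε m k c l := by
  induction k generalizing c with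
  | zero =>
    rw [boundedCount_zero_left, boundedFormula]
    by_cases hc : c = 0 ∧ l = m
    · obtain ⟨rfl, rfl⟩ := hc
      simp [ballot_zero_right]
    · rw [if_neg hc, if_neg (by omega)]
  | succ k ih =>
    rcases c with _ | c
    · rw [boundedCount_succ_zero χ (by omega), boundedFormula, if_neg (by omega)]
    · rw [boundedCount_succ_succ χ hk, boundedFormula_succ ε hk, h, ih (by omega), ih (by omega)]

/-- Induction on `m`: the exact counts for `m` determine the bounded ones for `m`, and together
these give the exact counts for `m + 1`. -/
theorem exactCount_eq (χ : ℤˣ →* ℤˣ) (m d a l : ℕ) :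
    exactCount χ m (d + 1) a l = exactFormula ((χ (-1) : ℤˣ) : ℤ) m (d + 1) a l := by
  have hε : ((χ (-1) : ℤˣ) : ℤ) = 1 ∨ ((χ (-1) : ℤˣ) : ℤ) = -1 := by
    rcases Int.units_eq_one_or (χ (-1)) with h | h <;> simp [h]
  have hzero (m d a l : ℕ) (h : m - 1 < d + 1 ∨ a = 0 ∨ l < a) :
      exactCount χ m (d + 1) a l = exactFormula ((χ (-1) : ℤˣ) : ℤ) m (d + 1) a l := by
    rw [exactCount_eq_zero χ (by omega), exactFormula, if_neg (by omega)]
  induction m generalizing d a l with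
  | zero => exact hzero _ _ _ _ (by omega)
  | succ m ih =>
    by_cases h : m + 1 - 1 < d + 1 ∨ a = 0 ∨ l < a
    · exact hzero _ _ _ _ h
    · obtain ⟨c, rfl⟩ : ∃ c, a = c + 1 := ⟨a - 1, by omega⟩
      obtain ⟨l, rfl⟩ : ∃ l', l = l' + 1 := ⟨l - 1, by omega⟩
      have hd : d < m := by omega
      have hb := boundedCount_eq_of_exactCount χ ih
      rw [exactCount_succ_succ χ hd, exactFormula_succ hε hd, ih, hb _ hd.le, hb _ hd.le]

/-! ### Halving the ballot numbers at `-1` -/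

/-- The difference in `h1` is `ballot 1 (a - 1) (b + 1)` by the unsigned recursion; written this
way, the hypothesis is vacuous for `a = 0`. -/
theorem ballot_neg_one_step (a : ℕ) (h0 : ∀ b, ballot (-1) (2 * a) (2 * b + 1) = 0)
    (h1 : ∀ b < a, ballot (-1) (2 * a) (2 * b + 2) = ballot 1 a (b + 1) - ballot 1 a b) (b : ℕ) :
    ballot (-1) (2 * a + 1) (2 * b) = ballot 1 a b ∧
      ballot (-1) (2 * a + 1) (2 * b + 1) = ballot 1 a b ∧
      ballot (-1) (2 * a + 2) (2 * b) = ballot 1 a b ∧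
      ballot (-1) (2 * a + 2) (2 * b + 1) = 0 := by
  have hodd : (-1 : ℤ) ^ (2 * b + 1) = -1 := (odd_two_mul_add_one b).neg_one_pow
  have hpair (hx : ballot (-1) (2 * a + 1) (2 * b) = ballot 1 a b)
      (hy : ballot (-1) (2 * a + 2) (2 * b) = ballot 1 a b) :
      ballot (-1) (2 * a + 1) (2 * b + 1) = ballot 1 a b ∧
        ballot (-1) (2 * a + 2) (2 * b + 1) = 0 := by
    by_cases hb : b ≤ a
    · have h2 : ballot (-1) (2 * a + 1) (2 * b + 1) = ballot 1 a b := by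
        rw [ballot_succ_succ _ (by omega), h0, hx]
        ring
      refine ⟨h2, ?_⟩
      rw [ballot_succ_succ _ (by omega), h2, hy, hodd]
      ring
    · rw [ballot_eq_zero _ (by omega), ballot_eq_zero _ (by omega), ballot_eq_zero _ (by omega)]
      exact ⟨rfl, rfl⟩
  suffices h : ballot (-1) (2 * a + 1) (2 * b) = ballot 1 a b ∧
      ballot (-1) (2 * a + 2) (2 * b) = ballot 1 a b from
    ⟨h.1, (hpair h.1 h.2).1, h.2, (hpair h.1 h.2).2⟩
  clear hpair hodd
  induction b with
  | zero => simp [ballot_zero_right]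
  | succ b ih =>
    have heven : (-1 : ℤ) ^ (2 * b + 2) = 1 := (show Even (2 * b + 2) from ⟨b + 1, by ring⟩).neg_one_pow
    have hodd : (-1 : ℤ) ^ (2 * b + 1) = -1 := (odd_two_mul_add_one b).neg_one_pow
    rw [show 2 * (b + 1) = 2 * b + 1 + 1 by ring]
    by_cases hb : b ≤ a
    · have h2 : ballot (-1) (2 * a + 1) (2 * b + 1) = ballot 1 a b := by
        rw [ballot_succ_succ _ (by omega), h0, ih.1]
        ring
      have h3 : ballot (-1) (2 * a + 1) (2 * b + 1 + 1) = ballot 1 a (b + 1) := by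
        rcases hb.lt_or_eq with hb | rfl
        · rw [ballot_succ_succ _ (by omega), h1 b hb, h2, heven]
          ring
        · rw [ballot_eq_zero _ (by omega), ballot_eq_zero _ (by omega)]
      refine ⟨h3, ?_⟩
      rw [ballot_succ_succ _ (by omega), h3, ballot_succ_succ _ (by omega), h2, ih.2, heven, hodd]
      ring
    · rw [ballot_eq_zero _ (by omega), ballot_eq_zero _ (by omega), ballot_eq_zero _ (by omega)]
      exact ⟨rfl, rfl⟩

theorem ballot_neg_one (a b : ℕ) :
    ballot (-1) (2 * a + 1) (2 * b) = ballot 1 a b ∧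
      ballot (-1) (2 * a + 1) (2 * b + 1) = ballot 1 a b ∧
      ballot (-1) (2 * a + 2) (2 * b) = ballot 1 a b ∧
      ballot (-1) (2 * a + 2) (2 * b + 1) = 0 := by
  induction a generalizing b with
  | zero =>
    exact ballot_neg_one_step 0 (fun b => ballot_zero_left _ _) (fun b hb => absurd hb (by omega)) b
  | succ a ih =>
    refine ballot_neg_one_step (a + 1) (fun b => (ih b).2.2.2) (fun b hb => ?_) b
    rw [ballot_succ_succ _ (by omega)]
    have := (ih (b + 1)).2.2.1
    rw [show 2 * (a + 1) = 2 * a + 2 by ring, show 2 * b + 2 = 2 * (b + 1) by ring, this]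
    ring

theorem exactCount_id (m d a l : ℕ) :
    exactCount (MonoidHom.id ℤˣ) m (d + 1) a l = exactFormula (-1) m (d + 1) a l := by
  rw [exactCount_eq]
  simp

theorem exactCount_one (m d a l : ℕ) :
    exactCount 1 m (d + 1) a l = exactFormula 1 m (d + 1) a l := by
  rw [exactCount_eq]
  simp

/-- Here the second ballot factor has an even first and an odd second argument, so it vanishes at
`-1`. -/
theorem exactCount_id_odd (m d b l : ℕ) :
    exactCount (MonoidHom.id ℤˣ) m (2 * d) (2 * b + 1) l = 0 := by
  rcases d with _ | d
  · rw [mul_zero, exactCount_zero_left, if_neg (by omega)]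
  · rw [show 2 * (d + 1) = 2 * d + 1 + 1 by ring, exactCount_id, exactFormula]
    split_ifs with h
    · rw [show 2 * b + 1 - 1 = 2 * b by omega,
        show 2 * d + 1 + 1 - (2 * b + 1) = 2 * (d - b) + 1 by omega]
      rcases b with _ | b
      · rw [mul_zero, ballot_zero_left, mul_zero]
      · rw [show 2 * (b + 1) = 2 * b + 2 by ring, (ballot_neg_one _ _).2.2.2, mul_zero]
    · rfl

theorem exactCount_id_two_mul_add_one (n d b k : ℕ) :
    exactCount (MonoidHom.id ℤˣ) (2 * n + 1) (2 * d) (2 * b) (2 * k + 1) =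
      exactCount 1 n d b k := by
  rcases d with _ | d
  · rw [mul_zero, exactCount_zero_left, exactCount_zero_left]
    exact if_congr (by omega) rfl rfl
  rw [show 2 * (d + 1) = 2 * d + 1 + 1 by ring, exactCount_id, exactCount_one]
  by_cases h : 1 ≤ b ∧ b ≤ d + 1 ∧ d + 1 + k < n + b ∧ n ≤ b + k ∧ b ≤ k ∧ k ≤ n
  · obtain ⟨c, rfl⟩ : ∃ c, b = c + 1 := ⟨b - 1, by omega⟩
    obtain ⟨v, rfl⟩ : ∃ v, d = c + v := ⟨d - c, by omega⟩
    obtain ⟨s, rfl⟩ : ∃ s, k = c + s + 1 := ⟨k - c - 1, by omega⟩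
    obtain ⟨u, rfl⟩ : ∃ u, n = c + s + u + 1 := ⟨n - (c + s + 1), by omega⟩
    have h1 := exactFormula_add (-1) (2 * c + 1) (2 * v) (2 * s + 1) (2 * u) (by omega) (by omega)
    rw [show 2 * (c + s + u + 1) + 1 = 2 * c + 1 + (2 * s + 1) + 2 * u + 1 by ring,
      show 2 * (c + v) + 1 + 1 = 2 * c + 1 + 2 * v + 1 by ring,
      show 2 * (c + 1) = 2 * c + 1 + 1 by ring,
      show 2 * (c + s + 1) + 1 = 2 * c + 1 + (2 * s + 1) + 1 by ring, h1,
      exactFormula_add 1 c v s u (by omega) (by omega),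
      show 2 * c + 1 + (2 * s + 1) + 1 = 2 * (c + s + 1) + 1 by ring,
      (ballot_neg_one _ _).1, (ballot_neg_one _ _).1, Even.neg_one_pow, one_pow]
    simp [Nat.even_add]
  · rw [exactFormula, if_neg (by omega), exactFormula, if_neg h]

/-- After halving, the first ballot factors of the two summands are the two terms of the unsigned
recursion for `ballot 1 k (n - k)`. -/
theorem exactCount_id_two_mul (n d b k : ℕ) :
    exactCount (MonoidHom.id ℤˣ) (2 * n) (2 * d) (2 * b) (2 * k + 1) +
      exactCount (MonoidHom.id ℤˣ) (2 * n) (2 * d) (2 * b) (2 * k) = exactCount 1 n d b k := by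
  rcases d with _ | d
  · rw [mul_zero, exactCount_zero_left, exactCount_zero_left, exactCount_zero_left,
      if_neg (by omega), zero_add]
    exact if_congr (by omega) rfl rfl
  rw [show 2 * (d + 1) = 2 * d + 1 + 1 by ring, exactCount_id, exactCount_id, exactCount_one]
  by_cases h : 1 ≤ b ∧ b ≤ d + 1 ∧ d + 1 + k < n + b ∧ n ≤ b + k ∧ b ≤ k ∧ k ≤ n
  · obtain ⟨c, rfl⟩ : ∃ c, b = c + 1 := ⟨b - 1, by omega⟩
    obtain ⟨v, rfl⟩ : ∃ v, d = c + v := ⟨d - c, by omega⟩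
    obtain ⟨s, rfl⟩ : ∃ s, k = c + s + 1 := ⟨k - c - 1, by omega⟩
    -- The conditions force `k < n`, so `n - k = w + 1` and the recursion applies.
    obtain ⟨w, rfl⟩ : ∃ w, n = c + s + (w + 1) + 1 := ⟨n - (c + s + 2), by omega⟩
    have h1 := exactFormula_add (-1) (2 * c + 1) (2 * v) (2 * s + 1) (2 * w + 1)
      (by omega) (by omega)
    have h2 := exactFormula_add (-1) (2 * c + 1) (2 * v) (2 * s) (2 * (w + 1))
      (by omega) (by omega)
    rw [show 2 * c + 1 + (2 * s + 1) + (2 * w + 1) + 1 = 2 * (c + s + (w + 1) + 1) by ring,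
      show 2 * c + 1 + 2 * v + 1 = 2 * (c + v) + 1 + 1 by ring,
      show 2 * c + 1 + 1 = 2 * (c + 1) by ring,
      show 2 * c + 1 + (2 * s + 1) + 1 = 2 * (c + s + 1) + 1 by ring,
      (ballot_neg_one _ _).2.1, (ballot_neg_one _ _).1, Even.neg_one_pow, one_mul] at h1
    · rw [show 2 * c + 1 + 2 * s + 2 * (w + 1) + 1 = 2 * (c + s + (w + 1) + 1) by ring,
        show 2 * c + 1 + 2 * v + 1 = 2 * (c + v) + 1 + 1 by ring,
        show 2 * c + 1 + 1 = 2 * (c + 1) by ring,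
        show 2 * c + 1 + 2 * s + 1 = 2 * (c + s) + 2 by ring,
        (ballot_neg_one _ _).2.2.1, (ballot_neg_one _ _).1, Even.neg_one_pow, one_mul] at h2
      · rw [h1, show 2 * (c + s + 1) = 2 * (c + s) + 2 by ring, h2,
          exactFormula_add 1 c v s (w + 1) (by omega) (by omega), ballot_succ_succ 1 (by omega)]
        ring
      · simp [Nat.even_add]
    · simp [Nat.even_add, Nat.even_mul]
  · rw [exactFormula, if_neg (by omega), exactFormula, if_neg (by omega), exactFormula, if_neg h,
      add_zero]

/-! ### Generating functions from refined counts -/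

theorem sum_range_two_mul {M : Type*} [AddCommMonoid M] (f : ℕ → M) (n : ℕ) :
    ∑ i ∈ Finset.range (2 * n), f i = ∑ i ∈ Finset.range n, (f (2 * i) + f (2 * i + 1)) := by
  induction n with
  | zero => simp
  | succ n ih =>
    rw [show 2 * (n + 1) = 2 * n + 1 + 1 by ring, Finset.sum_range_succ, Finset.sum_range_succ, ih,
      Finset.sum_range_succ, add_assoc]

theorem sum_T_eq {R : Type*} [CommRing R] (χ : ℤˣ →* ℤˣ) {m N : ℕ} (hN : m < N) (φ : ℕ → ℕ → R) :
    ∑ π ∈ T m, (weight χ π : R) * φ (lis π) (ldes π) =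
      ∑ l ∈ Finset.range N, ∑ d ∈ Finset.range N,
        (∑ a ∈ Finset.range N, (exactCount χ m d a l : R)) * φ l d := by
  have h (π : Equiv.Perm (Fin m)) : (weight χ π : R) * φ (lis π) (ldes π) =
      ∑ l ∈ Finset.range N, ∑ d ∈ Finset.range N, ∑ a ∈ Finset.range N,
        if ldes π = d ∧ prefixLis π d = a ∧ lis π = l then (weight χ π : R) * φ l d else 0 := by
    have h1 := lis_le π
    have h2 := ldes_le π
    have h3 := prefixLis_le_lis π (ldes π)
    rw [Finset.sum_eq_single_of_mem (lis π) (Finset.mem_range.2 (by omega)),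
      Finset.sum_eq_single_of_mem (ldes π) (Finset.mem_range.2 (by omega)),
      Finset.sum_eq_single_of_mem (prefixLis π (ldes π)) (Finset.mem_range.2 (by omega))]
    · simp
    · exact fun a _ ha => if_neg fun h => ha h.2.1.symm
    · exact fun d _ hd => Finset.sum_eq_zero fun a _ => if_neg fun h => hd h.1.symm
    · exact fun l _ hl => Finset.sum_eq_zero fun d _ => Finset.sum_eq_zero fun a _ =>
        if_neg fun h => hl h.2.2.symm
  rw [Finset.sum_congr rfl fun π _ => h π, Finset.sum_comm]
  refine Finset.sum_congr rfl fun l _ => ?_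
  rw [Finset.sum_comm]
  refine Finset.sum_congr rfl fun d _ => ?_
  rw [Finset.sum_comm, Finset.sum_mul]
  refine Finset.sum_congr rfl fun a _ => ?_
  rw [exactCount, Int.cast_sum, Finset.sum_mul]
  refine Finset.sum_congr rfl fun π _ => ?_
  split_ifs <;> simp

theorem sum_T_pow {R : Type*} [CommRing R] (q t : R) (n : ℕ) :
    ∑ π ∈ T n, q ^ (2 * lis π + 1) * t ^ (2 * ldes π) =
      ∑ k ∈ Finset.range (n + 1), ∑ d ∈ Finset.range (n + 1),
        ∑ b ∈ Finset.range (n + 1), (exactCount 1 n d b k : R) * (q ^ (2 * k + 1) * t ^ (2 * d)) := by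
  have h := sum_T_eq 1 n.lt_succ_self fun l d => q ^ (2 * l + 1) * t ^ (2 * d)
  simpa only [weight, MonoidHom.one_apply, Units.val_one, Int.cast_one, one_mul,
    Finset.sum_mul] using h

/-- Signed sums over the permutations with even last descent. -/
theorem sum_sign_eq {R : Type*} [CommRing R] (t : R) {m n : ℕ} (hm : m < 2 * (n + 1))
    (ψ : ℕ → R) :
    ∑ π ∈ T m, ((Equiv.Perm.sign π : ℤ) : R) * (if Even (ldes π) then ψ (lis π) * t ^ ldes π else 0)
      = ∑ k ∈ Finset.range (n + 1), ∑ d ∈ Finset.range (n + 1), ∑ b ∈ Finset.range (n + 1),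
        ((exactCount (MonoidHom.id ℤˣ) m (2 * d) (2 * b) (2 * k) : R) * ψ (2 * k) +
          (exactCount (MonoidHom.id ℤˣ) m (2 * d) (2 * b) (2 * k + 1) : R) * ψ (2 * k + 1)) *
            t ^ (2 * d) := by
  have h := sum_T_eq (MonoidHom.id ℤˣ) hm fun l d => if Even d then ψ l * t ^ d else 0
  simp only [weight, MonoidHom.id_apply] at h
  rw [h, sum_range_two_mul]
  refine Finset.sum_congr rfl fun k _ => ?_
  rw [sum_range_two_mul, sum_range_two_mul, ← Finset.sum_add_distrib]
  refine Finset.sum_congr rfl fun d _ => ?_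
  simp only [sum_range_two_mul, exactCount_id_odd, even_two_mul, if_true, Nat.not_even_two_mul_add_one, if_false,
    mul_zero, add_zero, Int.cast_zero]
  rw [Finset.sum_mul, Finset.sum_mul, ← Finset.sum_add_distrib]
  exact Finset.sum_congr rfl fun b _ => by ring

theorem sum_TOdd {R : Type*} [CommRing R] (q t : R) (m : ℕ) :
    ∑ π ∈ TOdd m, ((Equiv.Perm.sign π : ℤ) : R) * (q ^ lis π * t ^ ldes π) =
      ∑ π ∈ T m, ((Equiv.Perm.sign π : ℤ) : R) *
        (if Even (ldes π) then (if Odd (lis π) then q ^ lis π else 0) * t ^ ldes π else 0) := by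
  rw [TOdd, Finset.sum_filter]
  refine Finset.sum_congr rfl fun π _ => ?_
  rw [ite_and]
  split_ifs <;> simp

theorem sum_TEven {R : Type*} [CommRing R] (q t : R) (m : ℕ) :
    ∑ π ∈ TEven m, ((Equiv.Perm.sign π : ℤ) : R) * (q ^ lis π * t ^ ldes π) =
      ∑ π ∈ T m, ((Equiv.Perm.sign π : ℤ) : R) *
        (if Even (ldes π) then (if Even (lis π) then q ^ lis π else 0) * t ^ ldes π else 0) := by
  rw [TEven, Finset.sum_filter]
  refine Finset.sum_congr rfl fun π _ => ?_
  rw [ite_and]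
  split_ifs <;> simp

end SignBalance

theorem corollary4p4 {R : Type*} [CommRing R] (q t : R) (n : ℕ) (hn : 1 ≤ n) :
    (∑ π ∈ SignBalance.T n, q ^ (2 * SignBalance.lis π + 1) * t ^ (2 * SignBalance.ldes π) =
      ∑ π ∈ SignBalance.TOdd (2 * n + 1),
        ((Equiv.Perm.sign π : ℤ) : R) * (q ^ SignBalance.lis π * t ^ SignBalance.ldes π)) ∧
    (∑ π ∈ SignBalance.T n, q ^ (2 * SignBalance.lis π + 1) * t ^ (2 * SignBalance.ldes π) =
      (∑ π ∈ SignBalance.TOdd (2 * n),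
        ((Equiv.Perm.sign π : ℤ) : R) * (q ^ SignBalance.lis π * t ^ SignBalance.ldes π)) +
      q * ∑ π ∈ SignBalance.TEven (2 * n),
        ((Equiv.Perm.sign π : ℤ) : R) * (q ^ SignBalance.lis π * t ^ SignBalance.ldes π)) := by
  open SignBalance in
  rw [sum_T_pow, sum_TOdd, sum_TOdd, sum_TEven,
    sum_sign_eq t (n := n) (by omega) fun l => if Odd l then q ^ l else 0,
    sum_sign_eq t (n := n) (by omega) fun l => if Odd l then q ^ l else 0,
    sum_sign_eq t (n := n) (by omega) fun l => if Even l then q ^ l else 0]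
  simp only [even_two_mul, if_true, Nat.not_even_two_mul_add_one, if_false, odd_two_mul_add_one,
    Nat.not_odd_iff_even.2 (even_two_mul _), mul_zero, add_zero, zero_add]
  simp only [Finset.mul_sum, ← Finset.sum_add_distrib]
  constructor <;> refine Finset.sum_congr rfl fun k _ => Finset.sum_congr rfl fun d _ =>
    Finset.sum_congr rfl fun b _ => ?_
  · rw [SignBalance.exactCount_id_two_mul_add_one, mul_assoc]
  -- The extra factor `q` lifts `q ^ (2 * k)` to `q ^ (2 * k + 1)`, so the two adjacent `lis` values
  -- combine.
  · rw [← SignBalance.exactCount_id_two_mul, Int.cast_add]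
    ring
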